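/- Let $J_i,R_i\in\mathbb{R}^{n_i\times n_i}$ and $G_i\in\mathbb{R}^{n_i\times m}$ ($i=1,2$) be constant, $J_i^\top=-J_i$, $R_i=R_i^\top\succeq0$, and put $B_i=J_i-R_i$, $$A=\begin{bmatrix}B_1&-G_1G_2^\top\\0&B_2\end{bmatrix},\quad A_d=\begin{bmatrix}0&0\\G_2G_1^\top&0\end{bmatrix},\quad A_e=\begin{bmatrix}0\\G_2\end{bmatrix},\quad \mathcal G=\begin{bmatrix}G_1^\top&0\end{bmatrix}.$$ Let $M=M^\top\succ0$ (total energy $\mathcal H(\xi)=\frac12\xi^\top M\xi$ on $\mathbb{R}^{n_1+n_2}$) and let $\sigma>0$, $h>0$, $0<\tau_m\le\tau_M$, $\delta_M=\tau_M+h$. *Closed loop.* An admissible delay is a function $\tau$ with $\tau_m\le\tau(t)\le\tau_M$ for $t\ge0$ such that the instants $s_\ell=\ell h+\tau(\ell h)$, $\ell\in\mathbb{N}=\{0,1,2,\dots\}$, are non-decreasing. Let $\Omega=\Omega^\top\succ 0$ be an $m\times m$ matrix. With the output $y_1=\mathcal G M\xi$, the transmission instants are $t_0=0$ and $$t_{k+1}=\inf\{\ell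 h:\ \ell h>t_k,\ (y_1(t_k)-y_1(\ell h))^\top\Omega(y_1(t_k)-y_1(\ell h))-\sigma\, y_1(\ell h)^\top\Omega\, y_1(\ell h)\ge0\}$$ (with $\inf\emptyset=\infty$: no further transmission), and $e(\ell h)=y_1(t_k)-y_1(\ell h)$ for $t_k\le\ell h<t_{k+1}$. A trajectory is a continuous $\xi:[s_0-\delta_M,\infty)\to\mathbb{R}^{n_1+n_2}$ that satisfies $$\dot\xi(t)=AM\xi(t)+A_dM\xi(t-\delta(t))+A_e\,e(t-\delta(t)),\qquad \delta(t)=t-\ell h \text{ for } t\in[s_\ell,s_{\ell+1}),\ \ell\in\mathbb{N},$$ for all $t\ge s_0$ (right derivative); its restriction to $[s_0-\delta_M,s_0]$ is its initial function. *Claim.* Suppose that there are symmetric matrices $P\succ0$, $Q\succ0$ (of size $n_1+n_2$) and $\Omega\succ0$ (of size $m$) with $$\Xi_l=\begin{bmatrix}\Xi_{11}&\star&\star&\star\\ \Xi_{21}&\Xi_{22}&\star&\star\\ 6Q&6Q&-12Q&\star\\ \Xi_{41}&\Xi_{42}&0&\Xi_{44}\end{bmatrix}\prec0$$ ($\star$: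 entries given by symmetry), where $$\begin{aligned}\Xi_{11}&=\tfrac12(A+A^\top)+A^\top MP+PMA+\delta_M^2A^\top MQMA-4Q,\\ \Xi_{21}&=A_d^\top MP+\tfrac12A_d^\top+\delta_M^2A_d^\top MQMA-2Q,\\ \Xi_{22}&=\delta_M^2A_d^\top MQMA_d-4Q+\sigma\mathcal G^\top\Omega\mathcal G,\\ \Xi_{41}&=A_e^\top MP+\tfrac12A_e^\top+\delta_M^2A_e^\top MQMA,\\ \Xi_{42}&=\delta_M^2A_e^\top MQMA_d,\qquad \Xi_{44}=\delta_M^2A_e^\top MQMA_e-\Omega.\end{aligned}$$ Then the closed loop whose event-triggering mechanism uses this $\Omega$ is globally (uniformly) asymptotically stable: (i) for every $\varepsilon>0$ there is $\eta>0$ such that, for every admissible delay, every trajectory with $\|\xi(\theta)\|<\eta$ for all $\theta\in[s_0-\delta_M,s_0]$ satisfies $\|\xi(t)\|<\varepsilon$ for all $t\ge s_0$; (ii) for all $r,\varepsilon>0$ there is $T\ge0$ such that, for every admissible delay, every trajectory with $\|\xi(\theta)\|\le r$ for all $\theta\in[s_0-\delta_M,s_0]$ satisfies $\|\xi(t)\|<\varepsilon$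 for all $t\ge s_0+T$. In particular $\xi(t)\to0$ for every trajectory. -/

import Mathlib

open Matrix Filter Topology

noncomputable section

namespace EventTriggeredPH

/-- The constant matrices of a linear port-Hamiltonian system
`ẋ = (J - R) ∇H(x) + G u`, `y = Gᵀ ∇H(x)` with state in `ℝⁿ` and input and output in `ℝᵐ`:
the structure matrix `J` is skew-symmetric and the dissipation matrix `R` is symmetric
positive semidefinite. -/
structure LinearPHSubsystem (n m : ℕ) where
  J : Matrix (Fin n) (Fin n) ℝ
  R : Matrix (Fin n) (Fin n) ℝ
  G : Matrix (Fin n) (Fin m) ℝ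
  J_skew : Jᵀ = -J
  R_posSemidef : R.PosSemidef

section Interconnection

variable {n₁ n₂ m : ℕ} (S₁ : LinearPHSubsystem n₁ m) (S₂ : LinearPHSubsystem n₂ m)

/-- The matrix `A = [B₁, -G₁ G₂ᵀ; 0, B₂]` with `Bᵢ = Jᵢ - Rᵢ`. -/
def matA : Matrix (Fin n₁ ⊕ Fin n₂) (Fin n₁ ⊕ Fin n₂) ℝ :=
  fromBlocks (S₁.J - S₁.R) (-(S₁.G * S₂.Gᵀ)) 0 (S₂.J - S₂.R)

/-- The matrix `A_d = [0, 0; G₂ G₁ᵀ, 0]`. -/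
def matAd : Matrix (Fin n₁ ⊕ Fin n₂) (Fin n₁ ⊕ Fin n₂) ℝ :=
  fromBlocks 0 0 (S₂.G * S₁.Gᵀ) 0

/-- The matrix `A_e = [0; G₂]`. -/
def matAe : Matrix (Fin n₁ ⊕ Fin n₂) (Fin m) ℝ :=
  fromRows 0 S₂.G

/-- The matrix `𝒢 = [G₁ᵀ, 0]`. -/
def matG : Matrix (Fin m) (Fin n₁ ⊕ Fin n₂) ℝ :=
  fromCols S₁.Gᵀ 0

end Interconnection

/-- The symmetric block matrix `Ξ_l`; the block rows and columns correspond, in this order, to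
`∇𝓗(ξ(t))`, `∇𝓗(ξ(t - δ(t)))`, the mean of `∇𝓗(ξ)` over `[t - δ(t), t]`, and `e(t - δ(t))`. -/
def Xi {n m : Type*} [Fintype n] [Fintype m]
    (A Ad : Matrix n n ℝ) (Ae : Matrix n m ℝ) (𝒢 : Matrix m n ℝ) (M : Matrix n n ℝ)
    (σ δM : ℝ) (P Q : Matrix n n ℝ) (Ω : Matrix m m ℝ) :
    Matrix ((n ⊕ n) ⊕ (n ⊕ m)) ((n ⊕ n) ⊕ (n ⊕ m)) ℝ :=
  let Ξ₁₁ := (1 / 2 : ℝ) • (A + Aᵀ) + Aᵀ * M * P + P * M * A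
    + δM ^ 2 • (Aᵀ * M * Q * M * A) - (4 : ℝ) • Q
  let Ξ₂₁ := Adᵀ * M * P + (1 / 2 : ℝ) • Adᵀ + δM ^ 2 • (Adᵀ * M * Q * M * A) - (2 : ℝ) • Q
  let Ξ₂₂ := δM ^ 2 • (Adᵀ * M * Q * M * Ad) - (4 : ℝ) • Q + σ • (𝒢ᵀ * Ω * 𝒢)
  let Ξ₃₁ := (6 : ℝ) • Q
  let Ξ₃₂ := (6 : ℝ) • Q
  let Ξ₃₃ := -((12 : ℝ) • Q)
  let Ξ₄₁ := Aeᵀ * M * P + (1 / 2 : ℝ) • Aeᵀ + δM ^ 2 • (Aeᵀ * M * Q * M * A)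
  let Ξ₄₂ := δM ^ 2 • (Aeᵀ * M * Q * M * Ad)
  let Ξ₄₄ := δM ^ 2 • (Aeᵀ * M * Q * M * Ae) - Ω
  fromBlocks
    (fromBlocks Ξ₁₁ Ξ₂₁ᵀ Ξ₂₁ Ξ₂₂) (fromBlocks Ξ₃₁ᵀ Ξ₄₁ᵀ Ξ₃₂ᵀ Ξ₄₂ᵀ)
    (fromBlocks Ξ₃₁ Ξ₃₂ Ξ₄₁ Ξ₄₂) (fromBlocks Ξ₃₃ 0 0 Ξ₄₄)

section Trigger

variable {m : ℕ} (Ω : Matrix (Fin m) (Fin m) ℝ) (σ h : ℝ) (y : ℝ → Fin m → ℝ)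

/-- The triggering function `𝒞(e, y) = eᵀ Ω e - σ yᵀ Ω y`. -/
def triggerFun (e y : Fin m → ℝ) : ℝ :=
  e ⬝ᵥ (Ω *ᵥ e) - σ * (y ⬝ᵥ (Ω *ᵥ y))

/-- The transmission instants `t_k`, in units of the sampling period `h`: `t₀ = 0` and
`t_{k+1} = inf {ℓ h : ℓ h > t_k, 𝒞(y(t_k) - y(ℓ h), y(ℓ h)) ≥ 0}`.
The value `⊤` means that no further transmission takes place. -/
def transmission : ℕ → ℕ∞
  | 0 => 0
  | k + 1 => sInf {N : ℕ∞ | ∃ ℓ : ℕ, N = ℓ ∧ transmission k < ℓ ∧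
      0 ≤ triggerFun Ω σ (y ((transmission k).toNat * h) - y (ℓ * h)) (y (ℓ * h))}

open Classical in
/-- The sample index of the last transmission that is not later than the sample `ℓ`. -/
def lastTransmission (ℓ : ℕ) : ℕ :=
  Nat.findGreatest (fun j => ∃ k, transmission Ω σ h y k = (j : ℕ∞)) ℓ

/-- The error `e(ℓ h) = y(t_k) - y(ℓ h)`, where `t_k ≤ ℓ h < t_{k+1}`. -/
def sampleError (ℓ : ℕ) : Fin m → ℝ :=
  y (lastTransmission Ω σ h y ℓ * h) - y (ℓ * h)

end Trigger

/-- The instant `ℓ h + τ(ℓ h)`, at which the `ℓ`-th sampling interval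
`[ℓ h + τ(ℓ h), (ℓ + 1) h + τ((ℓ + 1) h))` begins. -/
def arrival (h : ℝ) (τ : ℝ → ℝ) (ℓ : ℕ) : ℝ :=
  ℓ * h + τ (ℓ * h)

/-- Network delays with values in `[τm, τM]` that do not change the order of the samples. -/
structure AdmissibleDelay (h τm τM : ℝ) (τ : ℝ → ℝ) : Prop where
  lower : ∀ t, 0 ≤ t → τm ≤ τ t
  upper : ∀ t, 0 ≤ t → τ t ≤ τM
  ordered : ∀ ℓ : ℕ, arrival h τ ℓ ≤ arrival h τ (ℓ + 1)

/-- `ξ` is a trajectory of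
`ξ̇(t) = A M ξ(t) + A_d M ξ(t - δ(t)) + A_e e(t - δ(t))` for `t ≥ t₀ = τ(0)`, the beginning of
the first sampling interval, with a continuous initial function on `[t₀ - δM, t₀]`.
The output is `y₁ = 𝒢 M ξ`, and the error `e` is produced by the event-triggering mechanism.
On the `ℓ`-th sampling interval `δ(t) = t - ℓ h`, so that `t - δ(t) = ℓ h`. The derivative is
the right derivative, because the right-hand side jumps where a sampling interval begins. -/
structure IsTrajectory {n₁ n₂ m : ℕ}
    (S₁ : LinearPHSubsystem n₁ m) (S₂ : LinearPHSubsystem n₂ m)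
    (M : Matrix (Fin n₁ ⊕ Fin n₂) (Fin n₁ ⊕ Fin n₂) ℝ) (Ω : Matrix (Fin m) (Fin m) ℝ)
    (σ h δM : ℝ) (τ : ℝ → ℝ) (ξ : ℝ → (Fin n₁ ⊕ Fin n₂) → ℝ) : Prop where
  continuousOn : ContinuousOn ξ (Set.Ici (arrival h τ 0 - δM))
  hasDeriv : ∀ (ℓ : ℕ) (t : ℝ), t ∈ Set.Ico (arrival h τ ℓ) (arrival h τ (ℓ + 1)) →
    HasDerivWithinAt ξ
      ((matA S₁ S₂ * M) *ᵥ ξ t + (matAd S₁ S₂ * M) *ᵥ ξ (ℓ * h)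
        + (matAe S₂ : Matrix (Fin n₁ ⊕ Fin n₂) (Fin m) ℝ) *ᵥ
          sampleError Ω σ h (fun s => (matG S₁ * M) *ᵥ ξ s) ℓ)
      (Set.Ici t) t

/-- Global (uniform) asymptotic stability of the zero solution of the event-triggered closed
loop: stability, and attraction from initial functions of arbitrary size, uniformly with respect
to the initial function and the admissible delay. Norms on `ℝⁿ` are equivalent, so the choice of
the maximum norm on the state space is immaterial. -/
structure GloballyAsymptoticallyStable {n₁ n₂ m : ℕ}
    (S₁ : LinearPHSubsystem n₁ m) (S₂ : LinearPHSubsystem n₂ m)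
    (M : Matrix (Fin n₁ ⊕ Fin n₂) (Fin n₁ ⊕ Fin n₂) ℝ) (Ω : Matrix (Fin m) (Fin m) ℝ)
    (σ h τm τM : ℝ) : Prop where
  stable : ∀ ε > 0, ∃ η > 0, ∀ τ, AdmissibleDelay h τm τM τ →
    ∀ ξ, IsTrajectory S₁ S₂ M Ω σ h (τM + h) τ ξ →
      (∀ θ ∈ Set.Icc (arrival h τ 0 - (τM + h)) (arrival h τ 0), ‖ξ θ‖ < η) →
      ∀ t ≥ arrival h τ 0, ‖ξ t‖ < ε
  attractive : ∀ r > 0, ∀ ε > 0, ∃ T ≥ 0, ∀ τ, AdmissibleDelay h τm τM τ →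
    ∀ ξ, IsTrajectory S₁ S₂ M Ω σ h (τM + h) τ ξ →
      (∀ θ ∈ Set.Icc (arrival h τ 0 - (τM + h)) (arrival h τ 0), ‖ξ θ‖ ≤ r) →
      ∀ t ≥ arrival h τ 0 + T, ‖ξ t‖ < ε

end EventTriggeredPH

end

/-! The proof is a Lyapunov–Krasovskii argument started one maximal delay `δ = τM + h` after `s₀`.
Let `q = (Mξ')ᵀ Q (Mξ')`, with `ξ'` the right derivative, let `K` be a primitive of `q`, and take `V
= ½ ξᵀMξ + (Mξ)ᵀP(Mξ) + δ ∫_{t-δ}^t (K(t) - K(s)) ds`. The integral is the usual double integral of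
`q`; its contribution to `V'` is `δ² q - X` with `X = δ (K(t) - K(t-δ))`.

On a sampling interval the delayed argument is `ℓh`, which lies in `[t-δ, t)`. The Wirtinger-based
inequality (`wirtingerForm_le`) on `[ℓh, t]` and the monotonicity of `K` bound `X` below by a
quadratic form in `Mξ(t)`, `Mξ(ℓh)` and the mean of `Mξ`. The triggering rule gives `eᵀΩe ≤ σ
y₁ᵀΩy₁` at every sample (`triggerFun_sampleError_nonpos`). With these two facts `V'` is at most the
quadratic form of `Ξ_l` (`quadForm_Xi`), and definiteness improves this to `V' ≤ -κ (‖Mξ‖² + X)`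
(`exists_dissipation`). Since `V ≤ D (‖Mξ‖² + X)`, `V` decays exponentially.

The initial function is merely continuous, so `V` makes sense only from `s₀ + δ` on. Before that, a
Grönwall bound (`norm_le_exp_of_norm_deriv_le`) controls `ξ` by the size of the initial function.
All constants are independent of the delay and the trajectory, which yields both uniform claims. -/

namespace EventTriggeredPH

/-! ### Norm bounds for matrices and quadratic forms -/

section Bounds

variable {n m : Type*} [Fintype n] [Fintype m]

theorem exists_norm_mulVec_le (N : Matrix m n ℝ) :
    ∃ C > 0, ∀ x : n → ℝ, ‖N *ᵥ x‖ ≤ C * ‖x‖ := by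
  let L := LinearMap.toContinuousLinearMap (Matrix.mulVecLin N)
  refine ⟨‖L‖ + 1, by positivity, fun x => ?_⟩
  have h := L.le_opNorm x
  have h' : L x = N *ᵥ x := rfl
  rw [h'] at h
  nlinarith [norm_nonneg x]

theorem abs_dotProduct_le (x y : n → ℝ) : |x ⬝ᵥ y| ≤ Fintype.card n * (‖x‖ * ‖y‖) := by
  calc |x ⬝ᵥ y| ≤ ∑ i, |x i * y i| := Finset.abs_sum_le_sum_abs _ _
    _ ≤ ∑ _i : n, ‖x‖ * ‖y‖ := by
        refine Finset.sum_le_sum fun i _ => ?_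
        rw [abs_mul]
        exact mul_le_mul (norm_le_pi_norm x i) (norm_le_pi_norm y i) (abs_nonneg _) (norm_nonneg _)
    _ = _ := by simp

theorem exists_abs_bilin_le (N : Matrix m n ℝ) :
    ∃ C > 0, ∀ (x : m → ℝ) (y : n → ℝ), |x ⬝ᵥ (N *ᵥ y)| ≤ C * (‖x‖ * ‖y‖) := by
  obtain ⟨C, hC, h⟩ := exists_norm_mulVec_le N
  refine ⟨(Fintype.card m + 1) * C, by positivity, fun x y => ?_⟩
  calc _ ≤ Fintype.card m * (‖x‖ * ‖N *ᵥ y‖) := abs_dotProduct_le _ _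
    _ ≤ (Fintype.card m + 1) * (‖x‖ * (C * ‖y‖)) := by
        gcongr
        · linarith
        · exact h y
    _ = _ := by ring

theorem exists_quadForm_le (N : Matrix n n ℝ) :
    ∃ C > 0, ∀ x : n → ℝ, x ⬝ᵥ (N *ᵥ x) ≤ C * ‖x‖ ^ 2 := by
  obtain ⟨C, hC, h⟩ := exists_abs_bilin_le N
  refine ⟨C, hC, fun x => ?_⟩
  have := (abs_le.1 (h x x)).2
  nlinarith

theorem quadForm_nonneg {N : Matrix n n ℝ} (hN : N.PosDef) (x : n → ℝ) :
    0 ≤ x ⬝ᵥ (N *ᵥ x) := by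
  simpa using hN.posSemidef.dotProduct_mulVec_nonneg x

/-- The minimum over the compact unit sphere is positive, and homogeneity extends the bound to all
vectors. The sphere is empty only in dimension zero. -/
theorem exists_le_quadForm {N : Matrix n n ℝ} (hN : N.PosDef) :
    ∃ c > 0, ∀ x : n → ℝ, c * ‖x‖ ^ 2 ≤ x ⬝ᵥ (N *ᵥ x) := by
  have hcont : Continuous fun x : n → ℝ => x ⬝ᵥ (N *ᵥ x) := by fun_prop
  obtain hem | hne := (Metric.sphere (0 : n → ℝ) 1).eq_empty_or_nonempty
  · refine ⟨1, one_pos, fun x => ?_⟩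
    have hx : x = 0 := by
      by_contra hx
      have : ‖x‖⁻¹ • x ∈ Metric.sphere (0 : n → ℝ) 1 := by
        simp [norm_smul, norm_ne_zero_iff.2 hx]
      simp [hem] at this
    simp [hx]
  · obtain ⟨z, hz, hmin⟩ := (isCompact_sphere (0 : n → ℝ) 1).exists_isMinOn hne hcont.continuousOn
    have hz0 : z ≠ 0 := by
      rintro rfl
      simp at hz
    refine ⟨z ⬝ᵥ (N *ᵥ z), by simpa using hN.dotProduct_mulVec_pos hz0, fun x => ?_⟩
    by_cases hx : x = 0
    · simp [hx]
    have hx' : 0 < ‖x‖ := norm_pos_iff.2 hx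
    have hmem : ‖x‖⁻¹ • x ∈ Metric.sphere (0 : n → ℝ) 1 := by
      simp [norm_smul, hx'.ne']
    have h := hmin hmem
    simp only [Set.mem_ofPred_eq, mulVec_smul, dotProduct_smul, smul_dotProduct, smul_eq_mul] at h
    calc _ ≤ (‖x‖⁻¹ * (‖x‖⁻¹ * (x ⬝ᵥ (N *ᵥ x)))) * ‖x‖ ^ 2 := by gcongr
      _ = _ := by field_simp

theorem bilin_comm {N : Matrix n n ℝ} (hN : Nᵀ = N) (x y : n → ℝ) :
    x ⬝ᵥ (N *ᵥ y) = y ⬝ᵥ (N *ᵥ x) := by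
  rw [dotProduct_mulVec, ← mulVec_transpose, hN, dotProduct_comm]

theorem dotProduct_transpose_mulVec_eq (N : Matrix m n ℝ) (x : n → ℝ) (y : m → ℝ) :
    x ⬝ᵥ (Nᵀ *ᵥ y) = (N *ᵥ x) ⬝ᵥ y := by
  rw [dotProduct_transpose_mulVec, dotProduct_comm]

end Bounds

/-! ### The quadratic form of `Ξ_l` -/

section Xi

variable {n m : Type*} [Fintype n] [Fintype m]

/-- The right-hand side of the Wirtinger-based inequality. -/
def wirtingerForm (Q : Matrix n n ℝ) (x y v : n → ℝ) : ℝ :=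
  (x - y) ⬝ᵥ (Q *ᵥ (x - y)) + 3 * ((x + y - (2 : ℝ) • v) ⬝ᵥ (Q *ᵥ (x + y - (2 : ℝ) • v)))

/-- With `x = Mξ(t)`, `y = Mξ(ℓh)` and the closed-loop field `f = Ax + A_d y + A_e e`, the terms are
the energy rate, the rate of `xᵀPx`, the term `δ² q`, the Wirtinger bound and the slack of the
triggering rule. -/
theorem quadForm_Xi (A Ad : Matrix n n ℝ) (Ae : Matrix n m ℝ) (𝒢 : Matrix m n ℝ)
    (M : Matrix n n ℝ) (σ δ : ℝ) (P Q : Matrix n n ℝ) (Ω : Matrix m m ℝ)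
    (hM : Mᵀ = M) (hP : Pᵀ = P) (hQ : Qᵀ = Q) (x y v : n → ℝ) (e : m → ℝ) :
    Sum.elim (Sum.elim x y) (Sum.elim v e) ⬝ᵥ
        (Xi A Ad Ae 𝒢 M σ δ P Q Ω *ᵥ Sum.elim (Sum.elim x y) (Sum.elim v e)) =
      x ⬝ᵥ (A *ᵥ x + Ad *ᵥ y + Ae *ᵥ e)
        + 2 * ((M *ᵥ (A *ᵥ x + Ad *ᵥ y + Ae *ᵥ e)) ⬝ᵥ (P *ᵥ x))
        + δ ^ 2 * ((M *ᵥ (A *ᵥ x + Ad *ᵥ y + Ae *ᵥ e)) ⬝ᵥ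
            (Q *ᵥ (M *ᵥ (A *ᵥ x + Ad *ᵥ y + Ae *ᵥ e))))
        - wirtingerForm Q x y v
        + (σ * ((𝒢 *ᵥ y) ⬝ᵥ (Ω *ᵥ (𝒢 *ᵥ y))) - e ⬝ᵥ (Ω *ᵥ e)) := by
  have hMv : ∀ u w : n → ℝ, u ⬝ᵥ (M *ᵥ w) = (M *ᵥ u) ⬝ᵥ w := fun u w => by
    rw [bilin_comm hM, dotProduct_comm]
  have c₁ := bilin_comm hP x (M *ᵥ (A *ᵥ x))
  have c₂ := bilin_comm hP x (M *ᵥ (Ad *ᵥ y))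
  have c₃ := bilin_comm hP x (M *ᵥ (Ae *ᵥ e))
  have d₁ := dotProduct_comm x (A *ᵥ x)
  have d₂ := dotProduct_comm x (Ad *ᵥ y)
  have d₃ := dotProduct_comm x (Ae *ᵥ e)
  simp only [Xi, wirtingerForm, fromBlocks_mulVec, Sum.elim_comp_inl, Sum.elim_comp_inr,
    sumElim_dotProduct_sumElim, transpose_add, transpose_sub, transpose_smul, transpose_mul,
    transpose_transpose, hM, hP, hQ, add_mulVec, sub_mulVec, neg_mulVec, smul_mulVec, zero_mulVec,
    mulVec_add, mulVec_sub, mulVec_smul, ← mulVec_mulVec, dotProduct_add, add_dotProduct,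
    dotProduct_sub, sub_dotProduct, dotProduct_smul, smul_dotProduct, dotProduct_neg,
    dotProduct_zero, dotProduct_transpose_mulVec_eq, hMv, smul_eq_mul]
  linear_combination c₁ + c₂ + c₃ - (1 / 2) * d₁ - (1 / 2) * d₂ - (1 / 2) * d₃

end Xi

/-! ### The triggering rule at every sample -/

section Trigger

variable {m : ℕ} (Ω : Matrix (Fin m) (Fin m) ℝ) (σ h : ℝ) (y : ℝ → Fin m → ℝ)

/-- A violation at a sample `ℓ` after its last transmission `j = t_k` would make `ℓ` a candidate for
`t_{k+1}`. Then `j < t_{k+1} ≤ ℓ`, against the maximality of `j`. At a transmission the error is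
zero. -/
theorem triggerFun_sampleError_nonpos (hσ : 0 < σ) (hΩ : Ω.PosDef) (ℓ : ℕ) :
    triggerFun Ω σ (sampleError Ω σ h y ℓ) (y (ℓ * h)) ≤ 0 := by
  classical
  set j := lastTransmission Ω σ h y ℓ with hj
  have hjℓ : j ≤ ℓ := Nat.findGreatest_le _
  have hP : ∃ k, transmission Ω σ h y k = (j : ℕ∞) := by
    have h0 : ∃ k, transmission Ω σ h y k = ((0 : ℕ) : ℕ∞) := ⟨0, by simp [transmission]⟩
    exact Nat.findGreatest_spec (P := fun j => ∃ k, transmission Ω σ h y k = (j : ℕ∞))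
      (Nat.zero_le ℓ) h0
  obtain hlt | heq := hjℓ.lt_or_eq
  · by_contra! hpos
    obtain ⟨k, hk⟩ := hP
    set S := {N : ℕ∞ | ∃ ℓ : ℕ, N = ℓ ∧ transmission Ω σ h y k < ℓ ∧
      0 ≤ triggerFun Ω σ (y ((transmission Ω σ h y k).toNat * h) - y (ℓ * h)) (y (ℓ * h))} with hS
    have hmem : (ℓ : ℕ∞) ∈ S := by
      refine ⟨ℓ, rfl, ?_, ?_⟩
      · rw [hk]; exact_mod_cast hlt
      · rw [hk]; exact hpos.le
    -- `ℕ∞` is well-ordered, so the infimum is attained and is itself a sample index.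
    obtain ⟨i, hi, hki, -⟩ := csInf_mem (⟨_, hmem⟩ : S.Nonempty)
    have hiℓ : i ≤ ℓ := by
      have : sInf S ≤ ℓ := sInf_le hmem
      rw [hi] at this
      exact_mod_cast this
    have hij : i ≤ j := Nat.le_findGreatest hiℓ ⟨k + 1, by rw [transmission]; exact hi⟩
    rw [hk] at hki
    have : j < i := by exact_mod_cast hki
    omega
  · have hy := quadForm_nonneg hΩ (y (ℓ * h))
    have : sampleError Ω σ h y ℓ = 0 := by
      simp [sampleError, ← hj, heq]
    rw [this, triggerFun]
    simp only [zero_dotProduct, zero_sub, Left.neg_nonpos_iff]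
    positivity

end Trigger

/-! ### Right derivatives and the Wirtinger-based inequality -/

theorem le_of_right_deriv_nonneg {f f' : ℝ → ℝ} {a b : ℝ} (hab : a ≤ b)
    (hf : ContinuousOn f (Set.Icc a b))
    (hf' : ∀ x ∈ Set.Ico a b, HasDerivWithinAt f (f' x) (Set.Ici x) x)
    (h0 : ∀ x ∈ Set.Ico a b, 0 ≤ f' x) : f a ≤ f b := by
  have := image_le_of_deriv_right_le_deriv_boundary (f := fun _ => f a) (f' := fun _ => 0)
    (B := f) (B' := f') continuousOn_const (fun x _ => hasDerivWithinAt_const _ _ _) le_rfl hf hf'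
    (fun x hx => h0 x hx)
  exact this ⟨hab, le_rfl⟩

section Calculus

variable {ι κ : Type*} [Fintype ι] [Fintype κ]

theorem hasDerivWithinAt_dotProduct {f g : ℝ → ι → ℝ} {f' g' : ι → ℝ} {s : Set ℝ} {t : ℝ}
    (hf : HasDerivWithinAt f f' s t) (hg : HasDerivWithinAt g g' s t) :
    HasDerivWithinAt (fun u => f u ⬝ᵥ g u) (f' ⬝ᵥ g t + f t ⬝ᵥ g') s t := by
  rw [hasDerivWithinAt_pi] at hf hg
  have := HasDerivWithinAt.fun_sum (u := Finset.univ) fun i _ => (hf i).mul (hg i)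
  simpa [dotProduct, Finset.sum_add_distrib] using this

theorem hasDerivWithinAt_mulVec (N : Matrix κ ι ℝ) {f : ℝ → ι → ℝ} {f' : ι → ℝ} {s : Set ℝ}
    {t : ℝ} (hf : HasDerivWithinAt f f' s t) :
    HasDerivWithinAt (fun u => N *ᵥ f u) (N *ᵥ f') s t :=
  (LinearMap.toContinuousLinearMap (Matrix.mulVecLin N)).hasFDerivAt.comp_hasDerivWithinAt t hf

theorem hasDerivWithinAt_quadForm {N : Matrix ι ι ℝ} (hN : Nᵀ = N) {f : ℝ → ι → ℝ} {f' : ι → ℝ}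
    {s : Set ℝ} {t : ℝ} (hf : HasDerivWithinAt f f' s t) :
    HasDerivWithinAt (fun u => f u ⬝ᵥ (N *ᵥ f u)) (2 * (f' ⬝ᵥ (N *ᵥ f t))) s t := by
  convert hasDerivWithinAt_dotProduct hf (hasDerivWithinAt_mulVec N hf) using 1
  rw [bilin_comm hN (f t) f']
  ring

theorem exists_primitive {E : Type*} [NormedAddCommGroup E] [NormedSpace ℝ E] [CompleteSpace E]
    {g : ℝ → E} {a b : ℝ} (hab : a ≤ b) (hg : ContinuousOn g (Set.Icc a b)) :
    ∃ G : ℝ → E, Continuous G ∧ ∀ s ∈ Set.Icc a b, HasDerivAt G (g s) s := by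
  have hc : Continuous (Set.IccExtend hab ((Set.Icc a b).domRestrict g)) :=
    (continuousOn_iff_continuous_domRestrict.1 hg).Icc_extend'
  have hd : ∀ s, HasDerivAt (fun s => ∫ u in a..s, Set.IccExtend hab ((Set.Icc a b).domRestrict g) u)
      (Set.IccExtend hab ((Set.Icc a b).domRestrict g) s) s := fun s =>
    (hc.integral_hasStrictDerivAt a s).hasDerivAt
  refine ⟨_, continuous_iff_continuousAt.2 fun s => (hd s).continuousAt, fun s hs => ?_⟩
  have := hd s
  rwa [Set.IccExtend_of_mem hab _ hs] at this

theorem two_mul_bilin_sub_le {Q : Matrix ι ι ℝ} (hQ : Q.PosDef) (u w : ι → ℝ) :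
    2 * (u ⬝ᵥ (Q *ᵥ w)) - w ⬝ᵥ (Q *ᵥ w) ≤ u ⬝ᵥ (Q *ᵥ u) := by
  have h := quadForm_nonneg hQ (u - w)
  have hs : Qᵀ = Q := hQ.isHermitian
  rw [mulVec_sub, sub_dotProduct, dotProduct_sub, dotProduct_sub, bilin_comm hs w u] at h
  linarith

/-- This is Bessel's inequality for `g'` with respect to the first two Legendre polynomials on `[a,
b]`: integrate `(g' - α - φβ)ᵀ Q (g' - α - φβ) ≥ 0`. Instead of integrating `g'`, the proof uses an
explicit primitive `F` of this expression, which is monotone. -/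
theorem wirtingerForm_le {Q : Matrix ι ι ℝ} (hQ : Q.PosDef) {g g' : ℝ → ι → ℝ} {K : ℝ → ℝ}
    {a b : ℝ} (hab : a < b) (hg : ContinuousOn g (Set.Icc a b))
    (hg' : ∀ t ∈ Set.Ico a b, HasDerivWithinAt g (g' t) (Set.Ici t) t)
    (hK : ContinuousOn K (Set.Icc a b))
    (hK' : ∀ t ∈ Set.Ico a b, HasDerivWithinAt K (g' t ⬝ᵥ (Q *ᵥ g' t)) (Set.Ici t) t) :
    ∃ v, wirtingerForm Q (g b) (g a) v ≤ (b - a) * (K b - K a) := by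
  have hs : Qᵀ = Q := hQ.isHermitian
  obtain ⟨G, hGc, hG⟩ := exists_primitive hab.le hg
  have hl : 0 < b - a := sub_pos.2 hab
  set l := b - a with hl_def
  -- `v` is the mean of `g`; `α` and `β` are the projection coefficients of `g'` on `1` and `φ`.
  -- Integration by parts gives `∫ φ g' = g b + g a - 2v`, and `∫ φ² = l / 3` explains the factor `3
  -- / l` in `β`.
  set v : ι → ℝ := l⁻¹ • (G b - G a) with hv
  set α : ι → ℝ := l⁻¹ • (g b - g a) with hα
  set β : ι → ℝ := (3 * l⁻¹) • (g b + g a - (2 : ℝ) • v) with hβ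
  set φ : ℝ → ℝ := fun s => 2 * l⁻¹ * (s - a) - 1 with hφ
  -- The term with `G` cancels the derivative of `φ` in the product `φ gᵀQβ`; the powers of `φ` are
  -- primitives of `2φ` and `φ²`.
  set F : ℝ → ℝ := fun s => K s - 2 * (g s ⬝ᵥ (Q *ᵥ α) + φ s * (g s ⬝ᵥ (Q *ᵥ β)))
    + 4 * l⁻¹ * (G s ⬝ᵥ (Q *ᵥ β)) + ((α ⬝ᵥ (Q *ᵥ α)) * s + (α ⬝ᵥ (Q *ᵥ β)) * (φ s ^ 2 * (l / 2))
      + (β ⬝ᵥ (Q *ᵥ β)) * (φ s ^ 3 * (l / 6))) with hF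
  have hφ' : ∀ s, HasDerivAt φ (2 * l⁻¹) s := fun s => by
    refine ((((hasDerivAt_id s).sub_const a).const_mul (2 * l⁻¹)).sub_const 1).congr_deriv ?_
    simp
  have hφc : Continuous φ := by fun_prop
  have hdot : ∀ c : ι → ℝ, Continuous fun u : ι → ℝ => u ⬝ᵥ c := fun c => by fun_prop
  have hFc : ContinuousOn F (Set.Icc a b) := by
    have h1 := fun c => (hdot c).comp_continuousOn hg
    have h2 := fun c => (hdot c).comp_continuousOn (hGc.continuousOn (s := Set.Icc a b))
    simp only [Function.comp_def] at h1 h2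
    have h3 := h1 (Q *ᵥ α)
    have h4 := h1 (Q *ᵥ β)
    have h5 := h2 (Q *ᵥ β)
    have h6 := hφc.continuousOn (s := Set.Icc a b)
    fun_prop
  have hc : ∀ (c : ι → ℝ) (s : ℝ), HasDerivWithinAt (fun _ : ℝ => c) 0 (Set.Ici s) s :=
    fun c s => hasDerivWithinAt_const _ _ _
  have hF' : ∀ s ∈ Set.Ico a b, HasDerivWithinAt F
      (g' s ⬝ᵥ (Q *ᵥ g' s) - 2 * (g' s ⬝ᵥ (Q *ᵥ (α + φ s • β)))
        + (α + φ s • β) ⬝ᵥ (Q *ᵥ (α + φ s • β))) (Set.Ici s) s := by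
    intro s hs'
    have d1 := hasDerivWithinAt_dotProduct (hg' s hs') (hc (Q *ᵥ α) s)
    have d2 := hasDerivWithinAt_dotProduct (hg' s hs') (hc (Q *ᵥ β) s)
    have d3 := hasDerivWithinAt_dotProduct
      (hG s (Set.Ico_subset_Icc_self hs')).hasDerivWithinAt (hc (Q *ᵥ β) s)
    have d4 := (hφ' s).hasDerivWithinAt (s := Set.Ici s)
    have d5 := (((hK' s hs').sub ((d1.add (d4.mul d2)).const_mul 2)).add
      (d3.const_mul (4 * l⁻¹))).add
      ((((hasDerivWithinAt_id s (Set.Ici s)).const_mul (α ⬝ᵥ (Q *ᵥ α))).add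
        (((d4.pow 2).mul_const (l / 2)).const_mul (α ⬝ᵥ (Q *ᵥ β)))).add
        (((d4.pow 3).mul_const (l / 6)).const_mul (β ⬝ᵥ (Q *ᵥ β))))
    refine d5.congr_deriv ?_
    simp only [dotProduct_zero, mulVec_add, mulVec_smul, dotProduct_add, add_dotProduct,
      dotProduct_smul, smul_dotProduct, smul_eq_mul, bilin_comm hs β α]
    field_simp
    ring
  have hmono := le_of_right_deriv_nonneg hab.le hFc hF' fun s _ => by
    linarith [two_mul_bilin_sub_le hQ (g' s) (α + φ s • β)]
  refine ⟨v, ?_⟩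
  have hφa : φ a = -1 := by simp [hφ]
  have hφb : φ b = 1 := by
    simp only [hφ, ← hl_def]
    field_simp
    norm_num
  have hGv : G b ⬝ᵥ (Q *ᵥ β) - G a ⬝ᵥ (Q *ᵥ β) = l * (v ⬝ᵥ (Q *ᵥ β)) := by
    rw [← sub_dotProduct, hv, smul_dotProduct, smul_eq_mul, mul_inv_cancel_left₀ hl.ne']
  have e1 : (g b - g a) ⬝ᵥ (Q *ᵥ α) = l * (α ⬝ᵥ (Q *ᵥ α)) := by
    rw [← smul_eq_mul, ← smul_dotProduct, hα, smul_inv_smul₀ hl.ne']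
  have hw : g b + g a - (2 : ℝ) • v = (l / 3) • β := by
    ext i
    simp only [hβ, Pi.smul_apply, smul_eq_mul]
    field_simp
  have e2 : (g b + g a - (2 : ℝ) • v) ⬝ᵥ (Q *ᵥ β) = l / 3 * (β ⬝ᵥ (Q *ᵥ β)) := by
    rw [hw, smul_dotProduct, smul_eq_mul]
  have e3 : (g b - g a) ⬝ᵥ (Q *ᵥ (g b - g a)) = l * (l * (α ⬝ᵥ (Q *ᵥ α))) := by
    have : g b - g a = l • α := by rw [hα, smul_inv_smul₀ hl.ne']
    rw [this, mulVec_smul, smul_dotProduct, dotProduct_smul, smul_eq_mul, smul_eq_mul]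
  have e4 : 3 * ((g b + g a - (2 : ℝ) • v) ⬝ᵥ (Q *ᵥ (g b + g a - (2 : ℝ) • v))) =
      l * (l / 3 * (β ⬝ᵥ (Q *ᵥ β))) := by
    rw [hw, mulVec_smul, smul_dotProduct, dotProduct_smul, smul_eq_mul, smul_eq_mul]
    ring
  have hG4 : 4 * l⁻¹ * (G b ⬝ᵥ (Q *ᵥ β)) - 4 * l⁻¹ * (G a ⬝ᵥ (Q *ᵥ β)) =
      4 * (v ⬝ᵥ (Q *ᵥ β)) := by
    rw [← mul_sub, hGv]
    field_simp
  rw [wirtingerForm, e3, e4, ← mul_add]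
  refine mul_le_mul_of_nonneg_left ?_ hl.le
  simp only [hF, hφa, hφb] at hmono
  simp only [sub_dotProduct, add_dotProduct, smul_dotProduct, smul_eq_mul] at e1 e2
  have hlb : (α ⬝ᵥ (Q *ᵥ α)) * b - (α ⬝ᵥ (Q *ᵥ α)) * a = l * (α ⬝ᵥ (Q *ᵥ α)) := by
    rw [hl_def]; ring
  linarith

end Calculus

/-! ### Sampling intervals and growth over a bounded time -/

section Delay

variable {h τm τM : ℝ} {τ : ℝ → ℝ}

theorem AdmissibleDelay.le_arrival (hτ : AdmissibleDelay h τm τM τ) (hh : 0 < h) (ℓ : ℕ) :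
    ℓ * h + τm ≤ arrival h τ ℓ := by
  have := hτ.lower (ℓ * h) (by positivity)
  rw [arrival]
  linarith

theorem AdmissibleDelay.arrival_le (hτ : AdmissibleDelay h τm τM τ) (hh : 0 < h) (ℓ : ℕ) :
    arrival h τ ℓ ≤ ℓ * h + τM := by
  have := hτ.upper (ℓ * h) (by positivity)
  rw [arrival]
  linarith

/-- The arrivals tend to infinity because `s_ℓ ≥ ℓh + τm`. Taking the least `ℓ` with `t < s_{ℓ+1}`
skips intervals that are empty because arrivals coincide. -/
theorem AdmissibleDelay.exists_mem_Ico (hτ : AdmissibleDelay h τm τM τ) (hh : 0 < h)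
    (hτm : 0 < τm) {t : ℝ} (ht : arrival h τ 0 ≤ t) :
    ∃ ℓ, t ∈ Set.Ico (arrival h τ ℓ) (arrival h τ (ℓ + 1)) := by
  classical
  have hex : ∃ ℓ, t < arrival h τ (ℓ + 1) := by
    obtain ⟨N, hN⟩ := exists_nat_gt (t / h)
    refine ⟨N, ?_⟩
    have := hτ.le_arrival hh (N + 1)
    rw [div_lt_iff₀ hh] at hN
    push_cast at this
    linarith
  refine ⟨Nat.find hex, ?_, Nat.find_spec hex⟩
  obtain h0 | ⟨k, hk⟩ : Nat.find hex = 0 ∨ ∃ k, Nat.find hex = k + 1 := by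
    cases Nat.find hex <;> simp
  · rwa [h0]
  · rw [hk]
    exact not_lt.1 (Nat.find_min hex (by omega))

theorem AdmissibleDelay.monotone (hτ : AdmissibleDelay h τm τM τ) : Monotone (arrival h τ) :=
  monotone_nat_of_le_succ hτ.ordered

/-- Induction over the sampling intervals: the past value `ξ(ℓh)` is already bounded by the same
nondecreasing barrier. Where `‖ξ‖` touches the barrier `B`, its growth rate is at most `2LB < 3LB =
B'`; the rate `3L` gives the strict inequality. -/
theorem norm_le_exp_of_norm_deriv_le {E : Type*} [NormedAddCommGroup E] [NormedSpace ℝ E]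
    (hτ : AdmissibleDelay h τm τM τ) (hh : 0 < h) (hτm : 0 < τm) {ξ : ℝ → E} {f : ℕ → ℝ → E}
    {L r : ℝ} (hL : 0 < L) (hr : 0 < r)
    (hξ : ContinuousOn ξ (Set.Ici (arrival h τ 0 - (τM + h))))
    (hf : ∀ ℓ, ∀ t ∈ Set.Ico (arrival h τ ℓ) (arrival h τ (ℓ + 1)),
      HasDerivWithinAt ξ (f ℓ t) (Set.Ici t) t)
    (hfL : ∀ ℓ t, ‖f ℓ t‖ ≤ L * (‖ξ t‖ + ‖ξ (ℓ * h)‖))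
    (h0 : ∀ θ ∈ Set.Icc (arrival h τ 0 - (τM + h)) (arrival h τ 0), ‖ξ θ‖ ≤ r)
    {t : ℝ} (ht : arrival h τ 0 - (τM + h) ≤ t) :
    ‖ξ t‖ ≤ r * Real.exp (3 * L * max (t - arrival h τ 0) 0) := by
  set s₀ := arrival h τ 0 with hs₀
  have hs₀M : s₀ ≤ τM := by simpa using hτ.arrival_le hh 0
  have hs₀m : τm ≤ s₀ := by simpa using hτ.le_arrival hh 0
  have hinit : ∀ t ∈ Set.Icc (s₀ - (τM + h)) s₀,
      ‖ξ t‖ ≤ r * Real.exp (3 * L * max (t - s₀) 0) := fun t ht => by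
    rw [max_eq_right (by linarith [ht.2])]
    simpa using h0 t ht
  have key : ∀ ℓ, ∀ t ∈ Set.Icc (s₀ - (τM + h)) (arrival h τ ℓ),
      ‖ξ t‖ ≤ r * Real.exp (3 * L * max (t - s₀) 0) := by
    intro ℓ
    induction ℓ with
    | zero => exact hinit
    | succ ℓ ih =>
      intro t ht
      obtain hle | hlt := le_total t (arrival h τ ℓ)
      · exact ih t ⟨ht.1, hle⟩
      have hsℓ : s₀ ≤ arrival h τ ℓ := hτ.monotone (Nat.zero_le ℓ)
      have hB : ∀ x, HasDerivAt (fun x => r * Real.exp (3 * L * (x - s₀)))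
          (r * (Real.exp (3 * L * (x - s₀)) * (3 * L))) x := fun x => by
        refine (((((hasDerivAt_id x).sub_const s₀).const_mul (3 * L)).exp).const_mul r).congr_deriv ?_
        simp
      have hmax : ∀ x, arrival h τ ℓ ≤ x → max (x - s₀) 0 = x - s₀ := fun x hx =>
        max_eq_left (by linarith)
      -- `ℓh` may precede `s₀`, but `s₀ ≤ τM` keeps it in the domain of the initial function.
      have hℓh : (ℓ : ℝ) * h ∈ Set.Icc (s₀ - (τM + h)) (arrival h τ ℓ) := by
        have h1 : 0 ≤ (ℓ : ℝ) * h := by positivity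
        exact ⟨by linarith, by linarith [hτ.le_arrival hh ℓ]⟩
      have := image_norm_le_of_norm_deriv_right_lt_deriv_boundary' (a := arrival h τ ℓ)
        (b := arrival h τ (ℓ + 1)) (hξ.mono fun x hx => Set.mem_Ici.2 (by linarith [hx.1]))
        (hf ℓ) (B := fun x => r * Real.exp (3 * L * (x - s₀)))
        (by simpa [hmax _ le_rfl] using ih _ ⟨by linarith, le_rfl⟩)
        (fun x _ => (hB x).continuousAt.continuousWithinAt)
        (fun x _ => (hB x).hasDerivWithinAt) ?_ ⟨hlt, ht.2⟩
      · rwa [hmax t hlt]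
      · intro x hx heq
        have hpos : 0 < r * Real.exp (3 * L * (x - s₀)) := by positivity
        have hpast : ‖ξ (ℓ * h)‖ ≤ r * Real.exp (3 * L * (x - s₀)) := by
          refine (ih _ hℓh).trans ?_
          gcongr
          refine max_le ?_ ?_ <;> linarith [hx.1, hℓh.2]
        have := hfL ℓ x
        rw [heq] at this
        nlinarith
  obtain hle | hle := le_total t s₀
  · exact hinit t ⟨ht, hle⟩
  · obtain ⟨ℓ, hℓ⟩ := hτ.exists_mem_Ico hh hτm hle
    exact key (ℓ + 1) t ⟨ht, hℓ.2.le⟩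

end Delay

/-! ### Exponential comparison and the delay functional -/

section Comparison

theorem le_mul_exp_of_right_deriv_le {V V' : ℝ → ℝ} {a b lam : ℝ} (hab : a ≤ b)
    (hV : ContinuousOn V (Set.Icc a b))
    (hV' : ∀ t ∈ Set.Ico a b, HasDerivWithinAt V (V' t) (Set.Ici t) t)
    (hle : ∀ t ∈ Set.Ico a b, V' t ≤ -lam * V t) :
    V b ≤ V a * Real.exp (-lam * (b - a)) := by
  have hE : ∀ t, HasDerivAt (fun t => Real.exp (lam * (t - a))) (Real.exp (lam * (t - a)) * lam) t :=
    fun t => by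
      refine ((((hasDerivAt_id t).sub_const a).const_mul lam).exp).congr_deriv ?_
      simp
  have h := le_of_right_deriv_nonneg (f := fun t => -(V t * Real.exp (lam * (t - a))))
    (f' := fun t => -(V' t * Real.exp (lam * (t - a)) + V t * (Real.exp (lam * (t - a)) * lam)))
    hab (hV.mul fun t _ => (hE t).continuousAt.continuousWithinAt).neg
    (fun t ht => ((hV' t ht).mul (hE t).hasDerivWithinAt).neg) fun t ht => by
      have := hle t ht
      have hp := Real.exp_pos (lam * (t - a))
      nlinarith
  simp only [sub_self, mul_zero, Real.exp_zero, mul_one, neg_le_neg_iff] at h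
  have hp := Real.exp_pos (lam * (b - a))
  rw [neg_mul, Real.exp_neg, ← div_eq_mul_inv, le_div_iff₀ hp]
  exact h

theorem exists_right_primitive {q : ℝ → ℝ} {s₀ : ℝ} (hm : Measurable q)
    (hq : ∀ t, s₀ ≤ t → ContinuousWithinAt q (Set.Ici t) t)
    (hb : ∀ t, s₀ ≤ t → ∃ B, ∀ s ∈ Set.Icc s₀ t, ‖q s‖ ≤ B) :
    ∃ K : ℝ → ℝ, K s₀ = 0 ∧ ContinuousOn K (Set.Ici s₀) ∧
      ∀ t, s₀ ≤ t → HasDerivWithinAt K (q t) (Set.Ici t) t := by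
  have hint : ∀ t, s₀ ≤ t → MeasureTheory.IntegrableOn q (Set.Icc s₀ t) := fun t ht => by
    obtain ⟨B, hB⟩ := hb t ht
    exact MeasureTheory.Measure.integrableOn_of_bounded (M := B) (by simp)
      hm.aestronglyMeasurable ((MeasureTheory.ae_restrict_iff' measurableSet_Icc).2
        (Eventually.of_forall hB))
  have hii : ∀ t, s₀ ≤ t → IntervalIntegrable q MeasureTheory.volume s₀ t := fun t ht =>
    (intervalIntegrable_iff_integrableOn_Icc_of_le ht).2 (hint t ht)
  refine ⟨fun t => ∫ s in s₀..t, q s, by simp, fun t ht => ?_, fun t ht => ?_⟩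
  · have ht' : s₀ ≤ t + 1 := by linarith [Set.mem_Ici.1 ht]
    have hc := intervalIntegral.continuousOn_primitive_interval (μ := MeasureTheory.volume)
      (f := q) (a := s₀) (b := t + 1) (by rw [Set.uIcc_of_le ht']; exact hint _ ht')
    rw [Set.uIcc_of_le ht'] at hc
    refine (hc t ⟨ht, by linarith⟩).mono_of_mem_nhdsWithin ?_
    rw [← Set.Ici_inter_Iic, mem_nhdsWithin]
    exact ⟨Set.Iio (t + 1), isOpen_Iio, by simp, fun x hx => ⟨hx.2, (Set.mem_Iio.1 hx.1).le⟩⟩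
  · exact intervalIntegral.integral_hasDerivWithinAt_right (hii t ht) (s := Set.Ici t)
      (t := Set.Ioi t) hm.stronglyMeasurable.stronglyMeasurableAtFilter
      ((hq t ht).mono Set.Ioi_subset_Ici_self)

/-- `U(t) = δ ∫_{t-δ}^t (K(t) - K(s)) ds`, with the inner integral of `q` already carried out.
Monotonicity of `K` puts the integrand between `0` and `K(t) - K(t-δ)`. -/
theorem exists_delay_functional {K q : ℝ → ℝ} {s₀ δ : ℝ} (hδ : 0 < δ)
    (hK : ContinuousOn K (Set.Ici s₀)) (hmono : MonotoneOn K (Set.Ici s₀))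
    (hK' : ∀ t, s₀ ≤ t → HasDerivWithinAt K (q t) (Set.Ici t) t) :
    ∃ U : ℝ → ℝ, ContinuousOn U (Set.Ici (s₀ + δ)) ∧ ∀ t, s₀ + δ ≤ t →
      0 ≤ U t ∧ U t ≤ δ * (δ * (K t - K (t - δ))) ∧
      HasDerivWithinAt U (δ ^ 2 * q t - δ * (K t - K (t - δ))) (Set.Ici t) t := by
  -- Extending `K` by a constant to the left of `s₀` makes its primitive differentiable everywhere.
  have hc : Continuous fun t => K (max t s₀) :=
    hK.comp_continuous (by fun_prop) fun t => Set.mem_Ici.2 (le_max_right _ _)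
  set Λ : ℝ → ℝ := fun t => ∫ s in s₀..t, K (max s s₀) with hΛ
  have hΛ' : ∀ t, HasDerivAt Λ (K (max t s₀)) t := fun t =>
    (hc.integral_hasStrictDerivAt s₀ t).hasDerivAt
  have hΛc : Continuous Λ := continuous_iff_continuousAt.2 fun t => (hΛ' t).continuousAt
  refine ⟨fun t => δ * (δ * K t - Λ t + Λ (t - δ)), ?_, fun t ht => ?_⟩
  · have : ContinuousOn K (Set.Ici (s₀ + δ)) := hK.mono (Set.Ici_subset_Ici.2 (by linarith))
    have h1 := hΛc.continuousOn (s := Set.Ici (s₀ + δ))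
    have h2 := (hΛc.comp (continuous_sub_right δ)).continuousOn (s := Set.Ici (s₀ + δ))
    simp only [Function.comp_def] at h2
    fun_prop
  have hdiff : Λ t - Λ (t - δ) = ∫ s in (t - δ)..t, K (max s s₀) :=
    intervalIntegral.integral_interval_sub_left (hc.intervalIntegrable _ _)
      (hc.intervalIntegrable _ _)
  have hlo : δ * K (t - δ) ≤ Λ t - Λ (t - δ) := by
    have := intervalIntegral.integral_mono_on
      (μ := MeasureTheory.volume) (a := t - δ) (b := t) (by linarith)
      (intervalIntegrable_const (c := K (t - δ))) (hc.intervalIntegrable _ _) fun s hs =>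
        hmono (Set.mem_Ici.2 (by linarith)) (Set.mem_Ici.2 (le_max_right _ _)) (le_max_of_le_left hs.1)
    rw [hdiff]
    simpa using this
  have hhi : Λ t - Λ (t - δ) ≤ δ * K t := by
    have := intervalIntegral.integral_mono_on
      (μ := MeasureTheory.volume) (a := t - δ) (b := t) (by linarith)
      (hc.intervalIntegrable _ _) (intervalIntegrable_const (c := K t)) fun s hs =>
        hmono (Set.mem_Ici.2 (le_max_right _ _)) (Set.mem_Ici.2 (by linarith))
          (max_le hs.2 (by linarith))
    rw [hdiff]
    simpa using this
  refine ⟨mul_nonneg hδ.le (by linarith), mul_le_mul_of_nonneg_left (by linarith) hδ.le, ?_⟩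
  have d1 := hΛ' t
  have d2 := (hΛ' (t - δ)).comp t ((hasDerivAt_id t).sub_const δ)
  have d3 := ((((hK' t (by linarith)).const_mul δ).sub d1.hasDerivWithinAt).add
    d2.hasDerivWithinAt).const_mul δ
  refine d3.congr_deriv ?_
  rw [max_eq_left (by linarith), max_eq_left (by linarith)]
  ring

end Comparison

/-! ### From definiteness of `Ξ_l` to strict dissipation -/

theorem exists_dissipation {n m : Type*} [Fintype n] [Fintype m]
    {A Ad : Matrix n n ℝ} {Ae : Matrix n m ℝ} {𝒢 : Matrix m n ℝ} {M : Matrix n n ℝ} {σ δ : ℝ}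
    {P Q : Matrix n n ℝ} {Ω : Matrix m m ℝ} (hM : Mᵀ = M) (hP : Pᵀ = P) (hQ : Qᵀ = Q)
    (hΞ : (-Xi A Ad Ae 𝒢 M σ δ P Q Ω).PosDef) :
    ∃ κ > 0, ∀ (x y v : n → ℝ) (e : m → ℝ) (f : n → ℝ) (X : ℝ),
      f = A *ᵥ x + Ad *ᵥ y + Ae *ᵥ e →
      e ⬝ᵥ (Ω *ᵥ e) - σ * ((𝒢 *ᵥ y) ⬝ᵥ (Ω *ᵥ (𝒢 *ᵥ y))) ≤ 0 →
      wirtingerForm Q x y v ≤ X →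
      x ⬝ᵥ f + 2 * ((M *ᵥ f) ⬝ᵥ (P *ᵥ x)) + δ ^ 2 * ((M *ᵥ f) ⬝ᵥ (Q *ᵥ (M *ᵥ f))) - X ≤
        -κ * (‖x‖ ^ 2 + X) := by
  obtain ⟨c, hc, hcΞ⟩ := exists_le_quadForm hΞ
  obtain ⟨C, hC, hCQ⟩ := exists_quadForm_le Q
  -- `52 = 2² + 3 · 4²` comes from `‖x - y‖ ≤ 2‖ζ‖` and `‖x + y - 2v‖ ≤ 4‖ζ‖`. So `c‖ζ‖²` dominates
  -- `κ‖x‖²` plus `κ` times the Wirtinger form, and `κ ≤ 1` allows that form to be replaced by the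
  -- larger `X`.
  refine ⟨min 1 (c / (52 * C + 1)), by positivity, fun x y v e f X hf he hX => ?_⟩
  set κ := min 1 (c / (52 * C + 1)) with hκ
  have hκ0 : 0 < κ := by positivity
  have hκ1 : κ ≤ 1 := min_le_left _ _
  have hκc : κ * (52 * C + 1) ≤ c := by
    rw [← le_div_iff₀ (by positivity)]
    exact min_le_right _ _
  set ζ : (n ⊕ n) ⊕ (n ⊕ m) → ℝ := Sum.elim (Sum.elim x y) (Sum.elim v e) with hζ
  have h1 := hcΞ ζ
  rw [neg_mulVec, dotProduct_neg, hζ, quadForm_Xi A Ad Ae 𝒢 M σ δ P Q Ω hM hP hQ, ← hf, ← hζ] at h1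
  have hz : 0 ≤ ‖ζ‖ := norm_nonneg ζ
  have hx : ‖x‖ ≤ ‖ζ‖ := (pi_norm_le_iff_of_nonneg hz).2 fun i =>
    norm_le_pi_norm ζ (Sum.inl (Sum.inl i))
  have hy : ‖y‖ ≤ ‖ζ‖ := (pi_norm_le_iff_of_nonneg hz).2 fun i =>
    norm_le_pi_norm ζ (Sum.inl (Sum.inr i))
  have hv : ‖v‖ ≤ ‖ζ‖ := (pi_norm_le_iff_of_nonneg hz).2 fun i =>
    norm_le_pi_norm ζ (Sum.inr (Sum.inl i))
  have hxy : ‖x - y‖ ≤ 2 * ‖ζ‖ := (norm_sub_le _ _).trans (by linarith)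
  have hxyv : ‖x + y - (2 : ℝ) • v‖ ≤ 4 * ‖ζ‖ := by
    refine (norm_sub_le _ _).trans ?_
    have := norm_add_le x y
    rw [norm_smul, Real.norm_ofNat]
    linarith
  have hW : wirtingerForm Q x y v ≤ 52 * C * ‖ζ‖ ^ 2 := by
    have e1 := hCQ (x - y)
    have e2 := hCQ (x + y - (2 : ℝ) • v)
    have e3 : C * ‖x - y‖ ^ 2 ≤ C * (2 * ‖ζ‖) ^ 2 := by gcongr
    have e4 : C * ‖x + y - (2 : ℝ) • v‖ ^ 2 ≤ C * (4 * ‖ζ‖) ^ 2 := by gcongr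
    rw [wirtingerForm]
    linarith
  have hx2 : κ * ‖x‖ ^ 2 ≤ κ * ‖ζ‖ ^ 2 := by gcongr
  have hW' : κ * wirtingerForm Q x y v ≤ κ * (52 * C * ‖ζ‖ ^ 2) := by gcongr
  have hc' : κ * (52 * C + 1) * ‖ζ‖ ^ 2 ≤ c * ‖ζ‖ ^ 2 := by gcongr
  have hX' : 0 ≤ (1 - κ) * (X - wirtingerForm Q x y v) :=
    mul_nonneg (by linarith) (by linarith)
  linarith

/-! ### Bounds and regularity of the closed-loop field -/

section Trajectory

variable {n₁ n₂ m : ℕ} (S₁ : LinearPHSubsystem n₁ m) (S₂ : LinearPHSubsystem n₂ m)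
  (M : Matrix (Fin n₁ ⊕ Fin n₂) (Fin n₁ ⊕ Fin n₂) ℝ) (Ω : Matrix (Fin m) (Fin m) ℝ)
  (σ h : ℝ)

/-- The right-hand side of the closed loop on the `ℓ`-th sampling interval. -/
noncomputable def closedLoopField (ξ : ℝ → (Fin n₁ ⊕ Fin n₂) → ℝ) (ℓ : ℕ) (t : ℝ) : (Fin n₁ ⊕ Fin n₂) → ℝ :=
  (matA S₁ S₂ * M) *ᵥ ξ t + (matAd S₁ S₂ * M) *ᵥ ξ (ℓ * h)
    + (matAe S₂ : Matrix (Fin n₁ ⊕ Fin n₂) (Fin m) ℝ) *ᵥ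
      sampleError Ω σ h (fun s => (matG S₁ * M) *ᵥ ξ s) ℓ

variable {Ω σ}

/-- The last transmitted output may be arbitrarily old; the triggering rule still bounds the error
by the current sample, through `c‖e‖² ≤ eᵀΩe ≤ σ yᵀΩy ≤ σC‖y‖²`. -/
theorem exists_norm_sampleError_le (hσ : 0 < σ) (hΩ : Ω.PosDef) :
    ∃ C > 0, ∀ (y : ℝ → Fin m → ℝ) (ℓ : ℕ),
      ‖sampleError Ω σ h y ℓ‖ ≤ C * ‖y (ℓ * h)‖ := by
  obtain ⟨c, hc, hcΩ⟩ := exists_le_quadForm hΩ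
  obtain ⟨C, hC, hCΩ⟩ := exists_quadForm_le Ω
  refine ⟨Real.sqrt (σ * C / c), by positivity, fun y ℓ => ?_⟩
  have h1 := triggerFun_sampleError_nonpos Ω σ h y hσ hΩ ℓ
  rw [triggerFun] at h1
  have h2 := hcΩ (sampleError Ω σ h y ℓ)
  have h3 := mul_le_mul_of_nonneg_left (hCΩ (y (ℓ * h))) hσ.le
  refine abs_le_of_sq_le_sq' ?_ (by positivity) |>.2
  rw [mul_pow, Real.sq_sqrt (by positivity), div_mul_eq_mul_div, le_div_iff₀ hc]
  linarith

theorem exists_norm_closedLoopField_le (hσ : 0 < σ) (hΩ : Ω.PosDef) :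
    ∃ L > 0, ∀ (ξ : ℝ → (Fin n₁ ⊕ Fin n₂) → ℝ) (ℓ : ℕ) (t : ℝ),
      ‖closedLoopField S₁ S₂ M Ω σ h ξ ℓ t‖ ≤ L * (‖ξ t‖ + ‖ξ (ℓ * h)‖) := by
  obtain ⟨C₁, h₁, hC₁⟩ := exists_norm_mulVec_le (matA S₁ S₂ * M)
  obtain ⟨C₂, h₂, hC₂⟩ := exists_norm_mulVec_le (matAd S₁ S₂ * M)
  obtain ⟨C₃, h₃, hC₃⟩ := exists_norm_mulVec_le (matAe (n₁ := n₁) S₂)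
  obtain ⟨C₄, h₄, hC₄⟩ := exists_norm_mulVec_le (matG (n₂ := n₂) S₁ * M)
  obtain ⟨C₅, h₅, hC₅⟩ := exists_norm_sampleError_le h hσ hΩ
  refine ⟨C₁ + C₂ + C₃ * (C₅ * C₄), by positivity, fun ξ ℓ t => ?_⟩
  have e1 := hC₁ (ξ t)
  have e2 := hC₂ (ξ (ℓ * h))
  have e3 : ‖matAe (n₁ := n₁) S₂ *ᵥ sampleError Ω σ h (fun s => (matG S₁ * M) *ᵥ ξ s) ℓ‖ ≤
      C₃ * (C₅ * (C₄ * ‖ξ (ℓ * h)‖)) := by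
    refine (hC₃ _).trans ?_
    gcongr
    refine (hC₅ _ _).trans ?_
    gcongr
    exact hC₄ _
  have p1 : 0 ≤ (C₂ + C₃ * (C₅ * C₄)) * ‖ξ t‖ := by positivity
  have p2 : 0 ≤ C₁ * ‖ξ (ℓ * h)‖ := by positivity
  calc _ ≤ ‖(matA S₁ S₂ * M) *ᵥ ξ t‖ + ‖(matAd S₁ S₂ * M) *ᵥ ξ (ℓ * h)‖
        + ‖matAe (n₁ := n₁) S₂ *ᵥ sampleError Ω σ h (fun s => (matG S₁ * M) *ᵥ ξ s) ℓ‖ :=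
        norm_add₃_le
    _ ≤ _ := by linarith

variable {S₁ S₂ M} {h τm τM : ℝ} {τ : ℝ → ℝ} {ξ : ℝ → (Fin n₁ ⊕ Fin n₂) → ℝ}

theorem IsTrajectory.derivWithin_eq (hξ : IsTrajectory S₁ S₂ M Ω σ h (τM + h) τ ξ) {ℓ : ℕ} {t : ℝ}
    (ht : t ∈ Set.Ico (arrival h τ ℓ) (arrival h τ (ℓ + 1))) :
    derivWithin ξ (Set.Ici t) t = closedLoopField S₁ S₂ M Ω σ h ξ ℓ t :=
  (hξ.hasDeriv ℓ t ht).derivWithin (uniqueDiffWithinAt_Ici t)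

theorem IsTrajectory.hasDerivWithinAt (hξ : IsTrajectory S₁ S₂ M Ω σ h (τM + h) τ ξ)
    (hτ : AdmissibleDelay h τm τM τ) (hh : 0 < h) (hτm : 0 < τm) {t : ℝ}
    (ht : arrival h τ 0 ≤ t) :
    HasDerivWithinAt ξ (derivWithin ξ (Set.Ici t) t) (Set.Ici t) t := by
  obtain ⟨ℓ, hℓ⟩ := hτ.exists_mem_Ico hh hτm ht
  exact (hξ.hasDeriv ℓ t hℓ).differentiableWithinAt.hasDerivWithinAt

/-- Sampling intervals are closed on the left and open on the right, so `ℓ` is constant just after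
`t`. Right continuity is what makes the primitive of `q` right differentiable at every point. -/
theorem IsTrajectory.continuousWithinAt_derivWithin
    (hξ : IsTrajectory S₁ S₂ M Ω σ h (τM + h) τ ξ)
    (hτ : AdmissibleDelay h τm τM τ) (hh : 0 < h) (hτm : 0 < τm) {t : ℝ}
    (ht : arrival h τ 0 ≤ t) :
    ContinuousWithinAt (fun s => derivWithin ξ (Set.Ici s) s) (Set.Ici t) t := by
  obtain ⟨ℓ, hℓ⟩ := hτ.exists_mem_Ico hh hτm ht
  have hc : ContinuousWithinAt (closedLoopField S₁ S₂ M Ω σ h ξ ℓ) (Set.Ici t) t := by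
    have h1 := hasDerivWithinAt_mulVec (matA S₁ S₂ * M) (hξ.hasDeriv ℓ t hℓ)
    exact (h1.continuousWithinAt.add continuousWithinAt_const).add continuousWithinAt_const
  refine hc.congr_of_eventuallyEq ?_ (hξ.derivWithin_eq hℓ)
  have : Set.Ico t (arrival h τ (ℓ + 1)) ∈ 𝓝[Set.Ici t] t := Ico_mem_nhdsGE hℓ.2
  filter_upwards [this] with s hs
  exact hξ.derivWithin_eq ⟨hℓ.1.trans hs.1, hs.2⟩

theorem IsTrajectory.norm_derivWithin_le (hξ : IsTrajectory S₁ S₂ M Ω σ h (τM + h) τ ξ)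
    (hτ : AdmissibleDelay h τm τM τ) (hh : 0 < h) (hτm : 0 < τm) {L r : ℝ} (hL : 0 < L)
    (hr : 0 < r)
    (hfL : ∀ (ℓ : ℕ) (t : ℝ),
      ‖closedLoopField S₁ S₂ M Ω σ h ξ ℓ t‖ ≤ L * (‖ξ t‖ + ‖ξ (ℓ * h)‖))
    (hB : ∀ t, arrival h τ 0 - (τM + h) ≤ t →
      ‖ξ t‖ ≤ r * Real.exp (3 * L * max (t - arrival h τ 0) 0))
    {t b : ℝ} (ht : t ∈ Set.Icc (arrival h τ 0) b) :
    ‖derivWithin ξ (Set.Ici t) t‖ ≤ 2 * L * (r * Real.exp (3 * L * (b - arrival h τ 0))) := by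
  have hs₀M : arrival h τ 0 ≤ τM := by simpa using hτ.arrival_le hh 0
  have hs₀m : τm ≤ arrival h τ 0 := by simpa using hτ.le_arrival hh 0
  obtain ⟨ℓ, hℓ⟩ := hτ.exists_mem_Ico hh hτm ht.1
  have h0 : 0 ≤ (ℓ : ℝ) * h := by positivity
  have h1 := hτ.le_arrival hh ℓ
  have hle : ∀ s, arrival h τ 0 - (τM + h) ≤ s → s ≤ b →
      ‖ξ s‖ ≤ r * Real.exp (3 * L * (b - arrival h τ 0)) := fun s hs hsb => by
    refine (hB s hs).trans ?_
    gcongr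
    exact max_le (by linarith) (by linarith [ht.1, ht.2])
  rw [hξ.derivWithin_eq hℓ]
  refine (hfL ℓ t).trans ?_
  have e1 := hle t (by linarith [ht.1]) ht.2
  have e2 := hle (ℓ * h) (by linarith) (by linarith [ht.2, hℓ.1])
  rw [mul_comm 2 L, mul_assoc]
  gcongr
  linarith

end Trajectory

theorem exists_norm_le_mulVec {n : Type*} [Fintype n] {M : Matrix n n ℝ} (hM : M.PosDef) :
    ∃ C > 0, ∀ x : n → ℝ, ‖x‖ ≤ C * ‖M *ᵥ x‖ := by
  obtain ⟨c, hc, hcM⟩ := exists_le_quadForm hM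
  refine ⟨(Fintype.card n + 1) / c, by positivity, fun x => ?_⟩
  obtain h0 | hpos := (norm_nonneg x).eq_or_lt
  · rw [← h0]; positivity
  have h1 := (hcM x).trans ((le_abs_self _).trans (abs_dotProduct_le x (M *ᵥ x)))
  rw [div_mul_eq_mul_div, le_div_iff₀ hc]
  refine le_of_mul_le_mul_left ?_ hpos
  have : 0 ≤ ‖x‖ * ‖M *ᵥ x‖ := by positivity
  linarith

/-! ### Dissipation along trajectories -/

section Trajectory

variable {n₁ n₂ m : ℕ} {S₁ : LinearPHSubsystem n₁ m} {S₂ : LinearPHSubsystem n₂ m}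
  {M : Matrix (Fin n₁ ⊕ Fin n₂) (Fin n₁ ⊕ Fin n₂) ℝ} {Ω : Matrix (Fin m) (Fin m) ℝ}
  {σ h τm τM : ℝ} {τ : ℝ → ℝ} {ξ : ℝ → (Fin n₁ ⊕ Fin n₂) → ℝ}

theorem IsTrajectory.exists_primitive_quadForm
    (hξ : IsTrajectory S₁ S₂ M Ω σ h (τM + h) τ ξ)
    (hτ : AdmissibleDelay h τm τM τ) (hh : 0 < h) (hτm : 0 < τm)
    (Q : Matrix (Fin n₁ ⊕ Fin n₂) (Fin n₁ ⊕ Fin n₂) ℝ)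
    (hb : ∀ t, arrival h τ 0 ≤ t → ∃ B, ∀ s ∈ Set.Icc (arrival h τ 0) t,
      ‖derivWithin ξ (Set.Ici s) s‖ ≤ B) :
    ∃ K : ℝ → ℝ, K (arrival h τ 0) = 0 ∧ ContinuousOn K (Set.Ici (arrival h τ 0)) ∧
      ∀ t, arrival h τ 0 ≤ t → HasDerivWithinAt K
        ((M *ᵥ derivWithin ξ (Set.Ici t) t) ⬝ᵥ (Q *ᵥ (M *ᵥ derivWithin ξ (Set.Ici t) t)))
        (Set.Ici t) t := by
  have hc : Continuous fun z : (Fin n₁ ⊕ Fin n₂) → ℝ => (M *ᵥ z) ⬝ᵥ (Q *ᵥ (M *ᵥ z)) := by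
    fun_prop
  refine exists_right_primitive (hc.measurable.comp (measurable_derivWithin_Ici ξ))
    (fun t ht => hc.continuousAt.comp_continuousWithinAt
      (hξ.continuousWithinAt_derivWithin hτ hh hτm ht)) fun t ht => ?_
  obtain ⟨B, hB⟩ := hb t ht
  obtain ⟨C, hC, hCQ⟩ := exists_abs_bilin_le Q
  obtain ⟨C', hC', hCM⟩ := exists_norm_mulVec_le M
  refine ⟨C * ((C' * B) * (C' * B)), fun s hs => (hCQ _ _).trans ?_⟩
  have : ‖M *ᵥ derivWithin ξ (Set.Ici s) s‖ ≤ C' * B := by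
    refine (hCM _).trans ?_
    gcongr
    exact hB s hs
  gcongr
  exact (norm_nonneg _).trans this

/-- Along a trajectory, the energy rate and the delay terms together are strictly dissipative. -/
theorem IsTrajectory.dissipation {P Q : Matrix (Fin n₁ ⊕ Fin n₂) (Fin n₁ ⊕ Fin n₂) ℝ}
    (hξ : IsTrajectory S₁ S₂ M Ω σ h (τM + h) τ ξ)
    (hτ : AdmissibleDelay h τm τM τ) (hh : 0 < h) (hτm : 0 < τm) (hσ : 0 < σ) (hΩ : Ω.PosDef)
    (hQ : Q.PosDef) {κ : ℝ}
    (hκ : ∀ (x y v : (Fin n₁ ⊕ Fin n₂) → ℝ) (e : Fin m → ℝ) (f : (Fin n₁ ⊕ Fin n₂) → ℝ) (X : ℝ),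
      f = matA S₁ S₂ *ᵥ x + matAd S₁ S₂ *ᵥ y + matAe S₂ *ᵥ e →
      e ⬝ᵥ (Ω *ᵥ e) - σ * ((matG S₁ *ᵥ y) ⬝ᵥ (Ω *ᵥ (matG S₁ *ᵥ y))) ≤ 0 →
      wirtingerForm Q x y v ≤ X →
      x ⬝ᵥ f + 2 * ((M *ᵥ f) ⬝ᵥ (P *ᵥ x)) + (τM + h) ^ 2 * ((M *ᵥ f) ⬝ᵥ (Q *ᵥ (M *ᵥ f))) - X ≤
        -κ * (‖x‖ ^ 2 + X))
    {K : ℝ → ℝ} (hK : ContinuousOn K (Set.Ici (arrival h τ 0)))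
    (hmono : MonotoneOn K (Set.Ici (arrival h τ 0)))
    (hK' : ∀ t, arrival h τ 0 ≤ t → HasDerivWithinAt K
        ((M *ᵥ derivWithin ξ (Set.Ici t) t) ⬝ᵥ (Q *ᵥ (M *ᵥ derivWithin ξ (Set.Ici t) t)))
        (Set.Ici t) t)
    {t : ℝ} (ht : arrival h τ 0 + (τM + h) ≤ t) :
    (M *ᵥ ξ t) ⬝ᵥ derivWithin ξ (Set.Ici t) t
      + 2 * ((M *ᵥ derivWithin ξ (Set.Ici t) t) ⬝ᵥ (P *ᵥ (M *ᵥ ξ t)))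
      + (τM + h) ^ 2 *
        ((M *ᵥ derivWithin ξ (Set.Ici t) t) ⬝ᵥ (Q *ᵥ (M *ᵥ derivWithin ξ (Set.Ici t) t)))
      - (τM + h) * (K t - K (t - (τM + h))) ≤
    -κ * (‖M *ᵥ ξ t‖ ^ 2 + (τM + h) * (K t - K (t - (τM + h)))) := by
  set s₀ := arrival h τ 0 with hs₀
  have hs₀M : s₀ ≤ τM := by simpa using hτ.arrival_le hh 0
  have hs₀m : τm ≤ s₀ := by simpa using hτ.le_arrival hh 0
  obtain ⟨ℓ, hℓ⟩ := hτ.exists_mem_Ico hh hτm (t := t) (by linarith)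
  have h1 := hτ.le_arrival hh ℓ
  have h2 := hτ.arrival_le hh (ℓ + 1)
  push_cast at h2
  -- `τm > 0` makes `[ℓh, t]` nondegenerate, and `t < s_{ℓ+1} ≤ (ℓ+1)h + τM` gives it length at most
  -- `δ`. As `t ≥ s₀ + δ`, it lies to the right of `s₀`, where `ξ` has right derivatives.
  have hlt : (ℓ : ℝ) * h < t := by linarith [hℓ.1]
  have hgt : t - (τM + h) ≤ ℓ * h := by linarith [hℓ.2]
  have hs : s₀ ≤ ℓ * h := by linarith
  have hξc : ContinuousOn (fun s => M *ᵥ ξ s) (Set.Icc (ℓ * h) t) := by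
    have hMc : Continuous fun z : (Fin n₁ ⊕ Fin n₂) → ℝ => M *ᵥ z := by fun_prop
    exact hMc.comp_continuousOn (hξ.continuousOn.mono fun s hs' =>
      Set.mem_Ici.2 (by linarith [hs'.1]))
  obtain ⟨v, hv⟩ := wirtingerForm_le hQ hlt hξc
    (fun s hs' => hasDerivWithinAt_mulVec M
      (hξ.hasDerivWithinAt hτ hh hτm (hs.trans hs'.1)))
    (hK.mono fun s hs' => Set.mem_Ici.2 (hs.trans hs'.1))
    (fun s hs' => hK' s (hs.trans hs'.1))
  have hm1 : K (t - (τM + h)) ≤ K (ℓ * h) :=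
    hmono (Set.mem_Ici.2 (by linarith)) (Set.mem_Ici.2 hs) hgt
  have hm2 : K (ℓ * h) ≤ K t := hmono (Set.mem_Ici.2 hs) (Set.mem_Ici.2 (by linarith)) hlt.le
  have hvX : wirtingerForm Q (M *ᵥ ξ t) (M *ᵥ ξ (ℓ * h)) v ≤
      (τM + h) * (K t - K (t - (τM + h))) := by
    refine hv.trans (mul_le_mul (by linarith) (by linarith) (by linarith) (by linarith))
  refine hκ _ (M *ᵥ ξ (ℓ * h)) v
    (sampleError Ω σ h (fun s => (matG S₁ * M) *ᵥ ξ s) ℓ) _ _ ?_ ?_ hvX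
  · rw [hξ.derivWithin_eq hℓ, closedLoopField, mulVec_mulVec, mulVec_mulVec]
  · have := triggerFun_sampleError_nonpos Ω σ h (fun s => (matG S₁ * M) *ᵥ ξ s) hσ hΩ ℓ
    rw [triggerFun] at this
    rwa [mulVec_mulVec]

end Trajectory

/-! ### Uniform exponential decay -/

theorem exists_exp_decay {n₁ n₂ m : ℕ}
    (S₁ : LinearPHSubsystem n₁ m) (S₂ : LinearPHSubsystem n₂ m)
    {M : Matrix (Fin n₁ ⊕ Fin n₂) (Fin n₁ ⊕ Fin n₂) ℝ} (hM : M.PosDef)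
    {σ h τm τM : ℝ} (hσ : 0 < σ) (hh : 0 < h) (hτm : 0 < τm) (hτmM : τm ≤ τM)
    {P Q : Matrix (Fin n₁ ⊕ Fin n₂) (Fin n₁ ⊕ Fin n₂) ℝ} {Ω : Matrix (Fin m) (Fin m) ℝ}
    (hP : P.PosDef) (hQ : Q.PosDef) (hΩ : Ω.PosDef)
    (hΞ : (-Xi (matA S₁ S₂) (matAd S₁ S₂) (matAe S₂) (matG S₁) M σ (τM + h) P Q Ω).PosDef) :
    ∃ C > 0, ∃ lam > 0, ∀ τ, AdmissibleDelay h τm τM τ →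
      ∀ ξ, IsTrajectory S₁ S₂ M Ω σ h (τM + h) τ ξ → ∀ r > 0,
      (∀ θ ∈ Set.Icc (arrival h τ 0 - (τM + h)) (arrival h τ 0), ‖ξ θ‖ ≤ r) →
      ∀ t ≥ arrival h τ 0, ‖ξ t‖ ^ 2 ≤ C * r ^ 2 * Real.exp (-lam * (t - arrival h τ 0)) := by
  have hMs : Mᵀ = M := hM.isHermitian
  have hPs : Pᵀ = P := hP.isHermitian
  obtain ⟨κ, hκ0, hκ⟩ := exists_dissipation hMs hPs hQ.isHermitian hΞ
  obtain ⟨c, hc, hcM⟩ := exists_le_quadForm hM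
  obtain ⟨C₀, hC₀, hC₀M⟩ := exists_norm_le_mulVec hM
  obtain ⟨C₁, hC₁, hC₁M⟩ := exists_norm_mulVec_le M
  obtain ⟨CH, hCH, hCHM⟩ := exists_quadForm_le M
  obtain ⟨CP, hCP, hCPP⟩ := exists_quadForm_le P
  obtain ⟨CQ, hCQ, hCQQ⟩ := exists_quadForm_le Q
  obtain ⟨L, hL, hLf⟩ := exists_norm_closedLoopField_le S₁ S₂ M h hσ hΩ
  set δ := τM + h with hδ_def
  have hδ : 0 < δ := by linarith
  -- `D` bounds `V` by `‖Mξ‖² + X`, using `U ≤ δX`. `R` is the growth factor up to `s₀ + δ`, `B r²`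
  -- bounds `q` on `[s₀, s₀ + δ]`, and `F r²` bounds `‖Mξ‖² + X` at `s₀ + δ`.
  set D := CH * C₀ ^ 2 + CP + δ with hD
  have hDpos : 0 < D := by positivity
  set R := Real.exp (3 * L * δ) with hR
  have hRpos : 0 < R := Real.exp_pos _
  set B := CQ * (C₁ * (2 * L * R)) ^ 2 with hB_def
  set F := C₁ ^ 2 * R ^ 2 + δ * (B * δ) with hF
  have hFpos : 0 < F := by positivity
  -- The first summand serves `t ≥ s₀ + δ`, the second the initial stretch; the exponential factor
  -- shifts the start of the decay from `s₀ + δ` back to `s₀`.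
  refine ⟨(D * F / (c / 2) + R ^ 2) * Real.exp (κ / D * δ), by positivity, κ / D, by positivity,
    fun τ hτ ξ hξ r hr hinit t ht => ?_⟩
  set s₀ := arrival h τ 0 with hs₀
  have hgrow : ∀ t, s₀ - δ ≤ t → ‖ξ t‖ ≤ r * Real.exp (3 * L * max (t - s₀) 0) := fun t ht =>
    norm_le_exp_of_norm_deriv_le hτ hh hτm hL hr hξ.continuousOn hξ.hasDeriv (hLf ξ) hinit ht
  have hshort : ∀ t, s₀ - δ ≤ t → t ≤ s₀ + δ → ‖ξ t‖ ≤ r * R := fun t ht ht' => by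
    refine (hgrow t ht).trans ?_
    rw [hR]
    gcongr
    exact max_le (by linarith) hδ.le
  have hexp : ∀ u, Real.exp (κ / D * δ) * Real.exp (-(κ / D) * (u - s₀)) =
      Real.exp (-(κ / D) * (u - (s₀ + δ))) := fun u => by
    rw [← Real.exp_add]
    congr 1
    ring
  have hderiv := fun {t b : ℝ} (ht : t ∈ Set.Icc s₀ b) =>
    hξ.norm_derivWithin_le hτ hh hτm hL hr (hLf ξ) hgrow ht
  rw [mul_right_comm, mul_assoc _ (Real.exp _) (Real.exp _), hexp]
  obtain htle | htle := le_total t (s₀ + δ)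
  · have h1 : 1 ≤ Real.exp (-(κ / D) * (t - (s₀ + δ))) := by
      rw [Real.one_le_exp_iff, neg_mul, Left.nonneg_neg_iff]
      exact mul_nonpos_of_nonneg_of_nonpos (by positivity) (by linarith)
    have h2 : ‖ξ t‖ ^ 2 ≤ (r * R) ^ 2 := by
      gcongr
      exact hshort t (by linarith) htle
    calc ‖ξ t‖ ^ 2 ≤ R ^ 2 * 1 * r ^ 2 := by linarith
      _ ≤ _ := by
        gcongr
        exact le_add_of_nonneg_left (by positivity)
  obtain ⟨K, hK0, hK, hK'⟩ := hξ.exists_primitive_quadForm hτ hh hτm Q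
    fun t ht => ⟨_, fun s hs => hderiv hs⟩
  rw [← hs₀] at hK0 hK hK'
  have hmono : MonotoneOn K (Set.Ici s₀) := fun a ha b hb hab =>
    le_of_right_deriv_nonneg hab (hK.mono fun x hx => Set.mem_Ici.2 (ha.trans hx.1))
      (fun x hx => hK' x (ha.trans hx.1)) fun x _ => quadForm_nonneg hQ _
  have hKB : K (s₀ + δ) ≤ B * r ^ 2 * δ := by
    have hs : s₀ ≤ s₀ + δ := by linarith
    have := le_of_right_deriv_nonneg (f := fun x => B * r ^ 2 * (x - s₀) - K x) hs
      (ContinuousOn.sub (by fun_prop) (hK.mono Set.Icc_subset_Ici_self))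
      (fun x hx => ((((hasDerivAt_id x).sub_const s₀).const_mul (B * r ^ 2)).hasDerivWithinAt).sub
        (hK' x hx.1)) fun x hx => by
        have h1 := hderiv (Set.Ico_subset_Icc_self hx)
        rw [add_sub_cancel_left, ← hR] at h1
        have h2 : ‖M *ᵥ derivWithin ξ (Set.Ici x) x‖ ≤ C₁ * (2 * L * (r * R)) := by
          refine (hC₁M _).trans ?_
          gcongr
        have h3 := hCQQ (M *ᵥ derivWithin ξ (Set.Ici x) x)
        have h4 : CQ * ‖M *ᵥ derivWithin ξ (Set.Ici x) x‖ ^ 2 ≤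
            CQ * (C₁ * (2 * L * (r * R))) ^ 2 := by gcongr
        rw [hB_def]
        linarith
    simp only [sub_self, mul_zero, hK0, add_sub_cancel_left] at this
    linarith
  obtain ⟨U, hU, hU'⟩ := exists_delay_functional hδ hK hmono hK'
  set V : ℝ → ℝ := fun t => 1 / 2 * (ξ t ⬝ᵥ (M *ᵥ ξ t)) + (M *ᵥ ξ t) ⬝ᵥ (P *ᵥ (M *ᵥ ξ t)) + U t
    with hV
  have hVc : ContinuousOn V (Set.Icc (s₀ + δ) t) := by
    have h1 : Continuous fun z : (Fin n₁ ⊕ Fin n₂) → ℝ =>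
        1 / 2 * (z ⬝ᵥ (M *ᵥ z)) + (M *ᵥ z) ⬝ᵥ (P *ᵥ (M *ᵥ z)) := by fun_prop
    exact (h1.comp_continuousOn (hξ.continuousOn.mono fun x hx =>
      Set.mem_Ici.2 (by linarith [hx.1]))).add (hU.mono Set.Icc_subset_Ici_self)
  have hVlo : c / 2 * ‖ξ t‖ ^ 2 ≤ V t := by
    have h1 := hcM (ξ t)
    have h2 := quadForm_nonneg hP (M *ᵥ ξ t)
    have h3 := (hU' t htle).1
    simp only [hV]
    linarith
  have hKX : ∀ s, s₀ + δ ≤ s → 0 ≤ δ * (K s - K (s - δ)) := fun s hs =>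
    mul_nonneg hδ.le (sub_nonneg.2 (hmono (Set.mem_Ici.2 (by linarith))
      (Set.mem_Ici.2 (by linarith)) (by linarith)))
  have hVhi : ∀ s, s₀ + δ ≤ s → V s ≤ D * (‖M *ᵥ ξ s‖ ^ 2 + δ * (K s - K (s - δ))) := by
    intro s hs
    have h1 := hCHM (ξ s)
    have h2 : CH * ‖ξ s‖ ^ 2 ≤ CH * (C₀ * ‖M *ᵥ ξ s‖) ^ 2 := by
      gcongr
      exact hC₀M _
    have h3 := hCPP (M *ᵥ ξ s)
    have h4 := (hU' s hs).2.1
    have h5 := hKX s hs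
    have h6 := quadForm_nonneg hM (ξ s)
    have h7 : 0 ≤ δ * ‖M *ᵥ ξ s‖ ^ 2 := by positivity
    have h8 : 0 ≤ (CH * C₀ ^ 2 + CP) * (δ * (K s - K (s - δ))) := mul_nonneg (by positivity) h5
    simp only [hV, hD]
    linarith
  have hdecay := le_mul_exp_of_right_deriv_le (lam := κ / D) htle hVc
    (fun s hs => by
      have hs' : s₀ ≤ s := by linarith [hs.1]
      have d1 := hξ.hasDerivWithinAt hτ hh hτm hs'
      exact (((hasDerivWithinAt_quadForm hMs d1).const_mul (1 / 2)).add
        (hasDerivWithinAt_quadForm hPs (hasDerivWithinAt_mulVec M d1))).add (hU' s hs.1).2.2)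
    fun s hs => by
      have h1 := hξ.dissipation hτ hh hτm hσ hΩ hQ hκ hK hmono hK' (t := s) hs.1
      have h2 := mul_le_mul_of_nonneg_left (hVhi s hs.1) (by positivity : 0 ≤ κ / D)
      rw [← mul_assoc, div_mul_cancel₀ _ hDpos.ne'] at h2
      rw [← hδ_def, dotProduct_comm] at h1
      linarith
  have hV1 : V (s₀ + δ) ≤ D * F * r ^ 2 := by
    refine (hVhi _ le_rfl).trans ?_
    rw [mul_assoc D F]
    refine mul_le_mul_of_nonneg_left ?_ hDpos.le
    rw [add_sub_cancel_right, hK0, sub_zero]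
    have h1 : ‖M *ᵥ ξ (s₀ + δ)‖ ^ 2 ≤ (C₁ * (r * R)) ^ 2 := by
      gcongr
      refine (hC₁M _).trans ?_
      gcongr
      exact hshort _ (by linarith) le_rfl
    have h2 := mul_le_mul_of_nonneg_left hKB hδ.le
    rw [hF]
    linarith
  have hE := Real.exp_pos (-(κ / D) * (t - (s₀ + δ)))
  have h1 : c / 2 * ‖ξ t‖ ^ 2 ≤ D * F * r ^ 2 * Real.exp (-(κ / D) * (t - (s₀ + δ))) :=
    hVlo.trans (hdecay.trans (mul_le_mul_of_nonneg_right hV1 hE.le))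
  rw [mul_comm, ← le_div_iff₀ (by positivity)] at h1
  refine h1.trans ?_
  have h2 : 0 ≤ R ^ 2 * (r ^ 2 * Real.exp (-(κ / D) * (t - (s₀ + δ)))) := by positivity
  have h3 : D * F * r ^ 2 * Real.exp (-(κ / D) * (t - (s₀ + δ))) / (c / 2) =
      D * F / (c / 2) * (r ^ 2 * Real.exp (-(κ / D) * (t - (s₀ + δ)))) := by ring
  rw [h3]
  linarith

end EventTriggeredPH

/-! ### Stability and uniform attraction from the decay estimate -/

theorem mainTheorem3 {n₁ n₂ m : ℕ}
    (S₁ : EventTriggeredPH.LinearPHSubsystem n₁ m) (S₂ : EventTriggeredPH.LinearPHSubsystem n₂ m)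
    (M : Matrix (Fin n₁ ⊕ Fin n₂) (Fin n₁ ⊕ Fin n₂) ℝ) (hM : M.PosDef)
    (σ h τm τM : ℝ) (hσ : 0 < σ) (hh : 0 < h) (hτm : 0 < τm) (hτ : τm ≤ τM)
    (P Q : Matrix (Fin n₁ ⊕ Fin n₂) (Fin n₁ ⊕ Fin n₂) ℝ) (Ω : Matrix (Fin m) (Fin m) ℝ)
    (hP : P.PosDef) (hQ : Q.PosDef) (hΩ : Ω.PosDef)
    (hΞ : (-EventTriggeredPH.Xi (EventTriggeredPH.matA S₁ S₂) (EventTriggeredPH.matAd S₁ S₂)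
      (EventTriggeredPH.matAe S₂) (EventTriggeredPH.matG S₁) M σ (τM + h) P Q Ω).PosDef) :
    EventTriggeredPH.GloballyAsymptoticallyStable S₁ S₂ M Ω σ h τm τM := by
  obtain ⟨C, hC, lam, hlam, hdecay⟩ :=
    EventTriggeredPH.exists_exp_decay S₁ S₂ hM hσ hh hτm hτ hP hQ hΩ hΞ
  constructor
  · intro ε hε
    -- With this radius `C r² = ε² / 4`; the factor `2` gives the strict inequality.
    refine ⟨ε / (2 * Real.sqrt C), by positivity, fun τ hadm ξ hξ hinit t ht => ?_⟩
    have h1 := hdecay τ hadm ξ hξ (ε / (2 * Real.sqrt C)) (by positivity)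
      (fun θ hθ => (hinit θ hθ).le) t ht
    have h2 : Real.exp (-lam * (t - EventTriggeredPH.arrival h τ 0)) ≤ 1 := by
      rw [Real.exp_le_one_iff, neg_mul, Left.neg_nonpos_iff]
      exact mul_nonneg hlam.le (sub_nonneg.2 ht)
    have h3 : C * (ε / (2 * Real.sqrt C)) ^ 2 = ε ^ 2 / 4 := by
      rw [div_pow, mul_pow, Real.sq_sqrt hC.le]
      field_simp
      norm_num
    rw [h3] at h1
    refine lt_of_pow_lt_pow_left₀ 2 hε.le (h1.trans_lt ?_)
    nlinarith [pow_pos hε 2]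
  · intro r hr ε hε
    have hlim : Tendsto (fun T : ℝ => C * r ^ 2 * Real.exp (-lam * T)) atTop (𝓝 0) := by
      have h1 : Tendsto (fun T : ℝ => -lam * T) atTop atBot :=
        tendsto_id.const_mul_atTop_of_neg (neg_lt_zero.2 hlam)
      simpa using (Real.tendsto_exp_atBot.comp h1).const_mul (C * r ^ 2)
    obtain ⟨T, hTε, hT0⟩ := ((hlim.eventually_lt_const (pow_pos hε 2)).and
      (eventually_ge_atTop 0)).exists
    refine ⟨T, hT0, fun τ hadm ξ hξ hinit t ht => ?_⟩
    have h1 := hdecay τ hadm ξ hξ r hr hinit t (by linarith)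
    refine lt_of_pow_lt_pow_left₀ 2 hε.le (h1.trans_lt (lt_of_le_of_lt ?_ hTε))
    gcongr C * r ^ 2 * Real.exp ?_
    exact mul_le_mul_of_nonpos_left (by linarith) (neg_nonpos.2 hlam.le)
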